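/- Let $\Gamma=(X,R)$ be a distance-regular graph (finite, simple, connected) with diameter $d\ge 3$, path-length distance $\partial$, intersection numbers $p^h_{ij}=|\{z\in X:\partial(x,z)=i,\ \partial(y,z)=j\}|$ (for any $x,y\in X$ with $\partial(x,y)=h$), valency $k=p^0_{11}$, $a_1=p^1_{11}$, $b_1=p^1_{12}$, and (distinct) adjacency eigenvalues $\theta_0>\theta_1>\cdots>\theta_d$. Suppose $a_1\neq 0$. For an edge $xy\in R$ let $D_1^1=D_1^1(x,y)$ be the set of common neighbours of $x$ and $y$ (so $|D_1^1|=a_1$), and let $$f(x,y)=a_1^{-1}\,\bigl|\{(z,w)\in D_1^1\times D_1^1:\ \partial(z,w)=2\}\bigr|,$$ the average valency of the complement of the subgraph induced on $D_1^1$. For $1\le i\le d$, let $E_i$ be the primitive idempotent of the Bose–Mesner algebra (the subalgebra of $\mathrm{Mat}_X(\mathbb R)$ generated by the adjacency matrix $A$) associated with $\theta_i$, i.e. its unique nonzero idempotent $E_i$ with $AE_i=\theta_iE_i$. For $z\in X$ let $\hat z\in\mathbb R^X$ be the vector with a $1$ in coordinate $z$ and $0$ elsewhere. Call the edge $xy$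 tight with respect to $\theta_i$ if the vectors $E_i\hat x$, $E_i\hat y$, $\sum_{z\in D_1^1}E_i\hat z$ are linearly dependent. Then for every edge $xy\in R$, $$b_1\,\frac{k+\theta_d(a_1+1)}{(k+\theta_d)(1+\theta_d)}\ \le\ f(x,y)\ \le\ b_1\,\frac{k+\theta_1(a_1+1)}{(k+\theta_1)(1+\theta_1)}.$$ Moreover, (i) $xy$ is tight with respect to $\theta_1$ if and only if equality holds in the right inequality; (ii) $xy$ is tight with respect to $\theta_d$ if and only if equality holds in the left inequality; (iii) $xy$ is not tight with respect to $\theta_i$ for $2\le i\le d-1$. -/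

import Mathlib

namespace SimpleGraph

variable {V : Type*} [Fintype V]

/-- The set `D_i^j(x, y) = Γ_i(x) ∩ Γ_j(y)` of vertices at distance `i` from `x` and at
distance `j` from `y`. -/
noncomputable def distCell (G : SimpleGraph V) (i j : ℕ) (x y : V) : Finset V :=
  Finset.univ.filter fun z => G.dist x z = i ∧ G.dist y z = j

/-- `G` is a (connected) distance-regular graph of diameter `d` with intersection numbers
`p h i j = p^h_{ij}`. Since every `h ≤ d` is the distance of some pair of vertices, `G`
determines `p h i j` for all `h, i, j ≤ d`. -/
structure IsDistanceRegularWith (G : SimpleGraph V) (d : ℕ) (p : ℕ → ℕ → ℕ → ℕ) : Prop where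
  connected : G.Connected
  diam_eq : G.diam = d
  card_distCell : ∀ h i j : ℕ, h ≤ d → i ≤ d → j ≤ d →
    ∀ x y : V, G.dist x y = h → (G.distCell i j x y).card = p h i j

/-- The average valency `f(x, y)` of the complement of the vertex subgraph induced on
`D_1^1(x, y)`: the number of ordered pairs of elements of `D_1^1(x, y)` at distance two,
divided by the size of `D_1^1(x, y)`. -/
noncomputable def avgCoValency (G : SimpleGraph V) (x y : V) : ℝ :=
  ((G.distCell 1 1 x y).card : ℝ)⁻¹ *
    (((G.distCell 1 1 x y ×ˢ G.distCell 1 1 x y).filter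
      fun q => G.dist q.1 q.2 = 2).card : ℝ)

variable [DecidableEq V]

/-- The Bose-Mesner algebra: the real matrix algebra generated by the adjacency matrix. -/
noncomputable def boseMesner (G : SimpleGraph V) [DecidableRel G.Adj] :
    Subalgebra ℝ (Matrix V V ℝ) :=
  Algebra.adjoin ℝ {G.adjMatrix ℝ}

/-- `E` is the primitive idempotent of the Bose-Mesner algebra associated with the
eigenvalue `θ`. For an eigenvalue `θ` there is exactly one such `E`, see
`existsUnique_isPrimitiveIdempotent`. -/
structure IsPrimitiveIdempotent (G : SimpleGraph V) [DecidableRel G.Adj] (θ : ℝ)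
    (E : Matrix V V ℝ) : Prop where
  mem_boseMesner : E ∈ G.boseMesner
  ne_zero : E ≠ 0
  mul_self : E * E = E
  adjMatrix_mul : G.adjMatrix ℝ * E = θ • E

open Polynomial in
theorem existsUnique_isPrimitiveIdempotent (G : SimpleGraph V) [DecidableRel G.Adj] (θ : ℝ)
    (hθ : θ ∈ spectrum ℝ (G.adjMatrix ℝ)) : ∃! E, G.IsPrimitiveIdempotent θ E := by
  set A := G.adjMatrix ℝ with hA
  have hmem : ∀ M : Matrix V V ℝ, M ∈ G.boseMesner ↔ ∃ q : ℝ[X], aeval A q = M := by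
    intro M
    rw [boseMesner, Algebra.adjoin_singleton_eq_range_aeval]
    rfl
  have hpow : ∀ (q : ℝ[X]) (F : Matrix V V ℝ), A * F = θ • F → aeval A q * F = q.eval θ • F := by
    intro q F hF
    induction q using Polynomial.induction_on' with
    | add p q hp hq => simp [add_mul, hp, hq, add_smul]
    | monomial n a =>
      have h1 : A ^ n * F = θ ^ n • F := by
        induction n with
        | zero => simp
        | succ n ih => rw [pow_succ, Matrix.mul_assoc, hF, Matrix.mul_smul, ih, smul_smul]; ring_nf
      simp [aeval_monomial, h1, Algebra.algebraMap_eq_smul_one, smul_smul]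
  have hherm : A.IsHermitian := by
    rw [Matrix.IsHermitian, Matrix.conjTranspose_eq_transpose_of_trivial]
    exact G.transpose_adjMatrix
  classical
  let s : Finset ℝ := Finset.univ.image hherm.eigenvalues
  have hs : θ ∈ s := by
    rw [hherm.spectrum_real_eq_range_eigenvalues] at hθ
    simpa [s] using hθ
  have hzero : aeval A (∏ μ ∈ s, (X - C μ)) = 0 := by
    refine Matrix.toLin'.injective ?_
    refine (hherm.eigenvectorBasis.toBasis.map
      (WithLp.linearEquiv 2 ℝ (V → ℝ))).ext fun i => ?_
    have hv := hherm.mulVec_eigenvectorBasis i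
    have key : ∀ q : ℝ[X], (aeval A q).mulVec (hherm.eigenvectorBasis i).ofLp
        = q.eval (hherm.eigenvalues i) • (hherm.eigenvectorBasis i).ofLp := by
      intro q
      induction q using Polynomial.induction_on' with
      | add p q hp hq => simp [Matrix.add_mulVec, hp, hq, add_smul]
      | monomial n a =>
        have h1 : (A ^ n).mulVec (hherm.eigenvectorBasis i).ofLp
            = (hherm.eigenvalues i) ^ n • (hherm.eigenvectorBasis i).ofLp := by
          induction n with
          | zero => simp
          | succ n ih =>
            rw [pow_succ, ← Matrix.mulVec_mulVec, hv, Matrix.mulVec_smul, ih, smul_smul]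
            ring_nf
        simp [aeval_monomial, Algebra.algebraMap_eq_smul_one, Matrix.smul_mulVec,
          h1, smul_smul]
    have h0 : (∏ μ ∈ s, (X - C μ)).eval (hherm.eigenvalues i) = 0 := by
      rw [eval_prod]
      exact Finset.prod_eq_zero (i := hherm.eigenvalues i) (by simp [s]) (by simp)
    have h3 := key (∏ μ ∈ s, (X - C μ))
    rw [h0, zero_smul] at h3
    simpa using h3
  let r : ℝ[X] := ∏ μ ∈ s.erase θ, (X - C μ)
  have hr : r.eval θ ≠ 0 := by
    rw [eval_prod]
    refine Finset.prod_ne_zero_iff.2 fun μ hμ => ?_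
    simpa [sub_eq_zero] using (Finset.ne_of_mem_erase hμ).symm
  let q : ℝ[X] := C (r.eval θ)⁻¹ * r
  have hq : q.eval θ = 1 := by simp [q, hr]
  have hAq : A * aeval A q = θ • aeval A q := by
    have h1 : aeval A ((X - C θ) * q) = 0 := by
      have : (X - C θ) * q = C (r.eval θ)⁻¹ * ∏ μ ∈ s, (X - C μ) := by
        rw [← Finset.mul_prod_erase s _ hs]
        simp only [q, r]
        ring
      rw [this, map_mul, hzero, mul_zero]
    rw [map_mul, map_sub, aeval_X, aeval_C, sub_mul, sub_eq_zero] at h1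
    rw [h1, Algebra.algebraMap_eq_smul_one, smul_mul_assoc, one_mul]
  have hne : aeval A q ≠ 0 := by
    intro h
    rw [hherm.spectrum_real_eq_range_eigenvalues] at hθ
    obtain ⟨i, hi⟩ := hθ
    let F : Matrix V V ℝ := Matrix.of fun a _ => (hherm.eigenvectorBasis i).ofLp a
    have hF : A * F = θ • F := by
      ext a b
      have := congrFun (hherm.mulVec_eigenvectorBasis i) a
      rw [hi] at this
      simpa [Matrix.mul_apply, Matrix.mulVec, dotProduct, F] using this
    have h2 := hpow q F hF
    rw [h, hq, one_smul, zero_mul] at h2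
    apply hherm.eigenvectorBasis.toBasis.ne_zero i
    ext a
    have := congrFun (congrFun h2 a) a
    simpa [F] using this.symm
  refine ⟨aeval A q, ⟨(hmem _).2 ⟨q, rfl⟩, hne, ?_, hAq⟩, ?_⟩
  · rw [hpow q _ hAq, hq, one_smul]
  · rintro E ⟨hE, hE0, hEE, hAE⟩
    obtain ⟨t, rfl⟩ := (hmem E).1 hE
    have ht : t.eval θ = 1 := by
      have h1 := hpow t _ hAE
      rw [hEE] at h1
      by_contra hne1
      apply hE0
      have h2 : (t.eval θ - 1) • aeval A t = 0 := by rw [sub_smul, ← h1, one_smul, sub_self]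
      exact (smul_eq_zero.1 h2).resolve_left (sub_ne_zero.2 hne1)
    have h1 := hpow t _ hAq
    have h2 := hpow q _ hAE
    rw [ht, one_smul] at h1
    rw [hq, one_smul] at h2
    calc aeval A t = aeval A q * aeval A t := h2.symm
      _ = aeval A t * aeval A q := by rw [← map_mul, ← map_mul, mul_comm]
      _ = aeval A q := h1

/-- The edge `xy` is tight with respect to the eigenvalue `θ`, with primitive idempotent `E`:
the vectors `E x̂`, `E ŷ`, `E w` are linearly dependent, where `w` is the sum of `ẑ` over the
common neighbours `z` of `x` and `y`. -/
def IsTightEdge (G : SimpleGraph V) [DecidableRel G.Adj] (θ : ℝ) (x y : V) : Prop :=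
  ∃ E : Matrix V V ℝ, G.IsPrimitiveIdempotent θ E ∧
    ¬ LinearIndependent ℝ
      ![E.mulVec (Pi.single x 1), E.mulVec (Pi.single y 1),
        E.mulVec (∑ z ∈ G.distCell 1 1 x y, Pi.single z 1)]

end SimpleGraph

/-! Fix an edge xy, let E be the idempotent of an eigenvalue θ < k, and let w be the sum of the
common neighbours. Inner products of columns of E depend only on distance, say e 0, e 1, e 2, and AE
= θE expresses e 1 and e 2 through e 0. The Gram determinant of Ex, Ey, Ew is therefore a positive
multiple of b₁(k + θ(a₁+1)) - f(k+θ)(1+θ). It is nonnegative, and it vanishes exactly when the edge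
is tight (`gram_three_of_isosceles`, `avgCoValency_mul_le`).

Since a₁ ≠ 0 gives k + θ > 0, dividing turns this into an upper or lower bound on f according to the
sign of 1 + θ. The matrix (A-k)(A+1) has zero diagonal but is not zero, so it has eigenvalues of
both signs (`exists_mem_spectrum`); this forces θ_d < -1 < θ₁. The bound strictly decreases on each
side of -1 (`tight_bound_lt`), so tightness at an intermediate eigenvalue would violate one of the
two extreme bounds. -/

section

open Finset Matrix

/-! ### Linear algebra: spectra and Gram determinants -/

/-- A real Hermitian matrix with a zero principal `2 × 2` diagonal and a nonzero entry off it has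
a negative eigenvalue. -/
theorem Matrix.IsHermitian.exists_neg_mem_spectrum {V : Type*} [Fintype V] [DecidableEq V]
    {M : Matrix V V ℝ} (hM : M.IsHermitian) {u v : V} (hu : M u u = 0) (hv : M v v = 0)
    (huv : M u v ≠ 0) : ∃ μ ∈ spectrum ℝ M, μ < 0 := by
  by_contra! h
  have hpos : M.PosSemidef := by
    rw [hM.posSemidef_iff_eigenvalues_nonneg]
    intro i
    exact h _ (hM.spectrum_real_eq_range_eigenvalues ▸ Set.mem_range_self i)
  have hsymm : M v u = M u v := by simpa using hM.apply u v
  -- The quadratic form at e_u ± e_v is ±2 M u v; both signs cannot be nonnegative.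
  have key (t : ℝ) (ht : t = 1 ∨ t = -1) : 0 ≤ 2 * t * M u v := by
    have h1 := hpos.dotProduct_mulVec_nonneg (Pi.single u 1 + Pi.single v t)
    simp only [star_trivial, mulVec_add, add_dotProduct, dotProduct_add, single_dotProduct,
      mulVec_single, Pi.smul_apply, col_apply, MulOpposite.smul_eq_mul_unop, MulOpposite.unop_op,
      hu, hv, hsymm] at h1
    linarith
  have h1 := key 1 (Or.inl rfl)
  have h2 := key (-1) (Or.inr rfl)
  exact huv (by linarith)

/-- Spectral mapping for polynomials in a real Hermitian matrix. -/
theorem Matrix.IsHermitian.spectrum_aeval {V : Type*} [Fintype V] [DecidableEq V]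
    {A : Matrix V V ℝ} (hA : A.IsHermitian) (q : Polynomial ℝ) :
    spectrum ℝ (Polynomial.aeval A q) = q.eval '' spectrum ℝ A := by
  have hA' : IsSelfAdjoint A := hA
  rw [← cfc_polynomial q A, cfc_map_spectrum q.eval A hA' (Polynomial.continuousOn _)]

/-- Gram determinant criterion for three vectors `u, v, w` such that `u` and `v` have the same
norm and the same inner product with `w`. -/
theorem gram_three_of_isosceles {V : Type*} [Fintype V] {u v w : V → ℝ} {c s t r : ℝ}
    (huu : u ⬝ᵥ u = c) (hvv : v ⬝ᵥ v = c) (huv : u ⬝ᵥ v = s) (huw : u ⬝ᵥ w = t)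
    (hvw : v ⬝ᵥ w = t) (hww : w ⬝ᵥ w = r) (h1 : s < c) (h2 : 0 < c + s) :
    0 ≤ r * (c + s) - 2 * t ^ 2 ∧
      (¬ LinearIndependent ℝ ![u, v, w] ↔ r * (c + s) - 2 * t ^ 2 = 0) := by
  have hvu : v ⬝ᵥ u = s := by rw [dotProduct_comm, huv]
  have hwu : w ⬝ᵥ u = t := by rw [dotProduct_comm, huw]
  have hwv : w ⬝ᵥ v = t := by rw [dotProduct_comm, hvw]
  -- Up to the factor c + s, this is the component of w orthogonal to u and v. The full Gram
  -- determinant is c - s times the quantity in the statement.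
  set z : V → ℝ := (-t) • u + (-t) • v + (c + s) • w with hz
  have hzz : z ⬝ᵥ z = (c + s) * (r * (c + s) - 2 * t ^ 2) := by
    simp only [hz, add_dotProduct, dotProduct_add, smul_dotProduct, dotProduct_smul, smul_eq_mul,
      huu, hvv, huv, huw, hvw, hww, hvu, hwu, hwv]
    ring
  have hz0 : z = 0 ↔ r * (c + s) - 2 * t ^ 2 = 0 := by
    rw [← dotProduct_self_eq_zero, hzz, mul_eq_zero, or_iff_right h2.ne']
  refine ⟨?_, ?_⟩
  · refine nonneg_of_mul_nonneg_right (b := r * (c + s) - 2 * t ^ 2) (a := c + s) ?_ h2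
    rw [← hzz]
    exact Finset.sum_nonneg fun i _ => mul_self_nonneg _
  rw [← hz0]
  constructor
  · intro h
    simp only [Fintype.linearIndependent_iff, not_forall] at h
    obtain ⟨g, hg, i, hi⟩ := h
    simp only [Fin.sum_univ_three, cons_val_zero, cons_val_one, Matrix.cons_val] at hg
    have e1 := congrArg (u ⬝ᵥ ·) hg
    have e2 := congrArg (v ⬝ᵥ ·) hg
    simp only [dotProduct_add, dotProduct_smul, smul_eq_mul, dotProduct_zero, huu, hvv, huv, hvu,
      huw, hvw] at e1 e2
    have e3 : g 0 = g 1 := by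
      have : (g 0 - g 1) * (c - s) = 0 := by linear_combination e1 - e2
      exact sub_eq_zero.1 ((mul_eq_zero.1 this).resolve_right (by linarith))
    have e4 : (c + s) * g 0 = -(t * g 2) := by rw [← e3] at e1; linear_combination e1
    have hg2 : g 2 ≠ 0 := by
      intro h0
      have h3 : g 0 = 0 := by
        rw [h0, mul_zero, neg_zero] at e4
        exact (mul_eq_zero.1 e4).resolve_left h2.ne'
      fin_cases i
      · exact hi h3
      · exact hi (e3 ▸ h3)
      · exact hi h0
    have h4 : g 2 • z = 0 := by
      have h5 : g 2 • z = (c + s) • (g 0 • u + g 1 • v + g 2 • w) := by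
        rw [← e3, hz]
        simp only [smul_add, smul_smul, e4]
        rw [mul_neg, mul_comm t, mul_comm (g 2) (c + s)]
      rw [h5, hg, smul_zero]
    exact (smul_eq_zero.1 h4).resolve_left hg2
  · intro h hli
    have := Fintype.linearIndependent_iff.1 hli ![-t, -t, c + s]
      (by simpa [Fin.sum_univ_three, hz] using h) 2
    simp at this
    linarith

/-! ### Counting by distance -/

namespace SimpleGraph

variable {V : Type*} [Fintype V] {G : SimpleGraph V} {d : ℕ} {p : ℕ → ℕ → ℕ → ℕ}

theorem mem_distCell {i j : ℕ} {x y z : V} :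
    z ∈ G.distCell i j x y ↔ G.dist x z = i ∧ G.dist y z = j := by
  simp [distCell]

namespace IsDistanceRegularWith

theorem dist_le (hG : G.IsDistanceRegularWith d p) (x y : V) : G.dist x y ≤ d := by
  have : Nonempty V := ⟨x⟩
  rw [← hG.diam_eq]
  exact dist_le_diam (connected_iff_ediam_ne_top.1 hG.connected)

/-- Every number up to the diameter is a distance. -/
theorem exists_dist_eq (hG : G.IsDistanceRegularWith d p) {i : ℕ} (hi : i ≤ d) :
    ∃ x y, G.dist x y = i := by
  have := hG.connected.nonempty
  obtain ⟨x, y, hxy⟩ := G.exists_dist_eq_diam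
  rw [hG.diam_eq] at hxy
  -- The i-th vertex of a geodesic of length d is at distance exactly i from its start, since a
  -- shortcut would shorten the whole.
  obtain ⟨w, hw⟩ := hG.connected.exists_walk_length_eq_dist x y
  refine ⟨x, w.getVert i, le_antisymm ((SimpleGraph.dist_le (w.take i)).trans ?_) ?_⟩
  · simp
  · have h1 := hG.connected.dist_triangle (u := x) (v := w.getVert i) (w := y)
    have h2 := SimpleGraph.dist_le (w.drop i)
    simp only [Walk.drop_length] at h2
    omega

/-- A sum over the vertices whose terms depend only on the distances to `x` and `y`. -/
theorem sum_dist (hG : G.IsDistanceRegularWith d p) (F : ℕ → ℕ → ℝ) (x y : V) :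
    ∑ z, F (G.dist x z) (G.dist y z) =
      ∑ i ∈ range (d + 1), ∑ j ∈ range (d + 1), p (G.dist x y) i j * F i j := by
  have hm : ∀ z ∈ (univ : Finset V),
      (G.dist x z, G.dist y z) ∈ range (d + 1) ×ˢ range (d + 1) := fun z _ => by
    simp [hG.dist_le]
  rw [← sum_product', ← sum_fiberwise_of_maps_to hm]
  refine sum_congr rfl fun q hq => ?_
  simp only [mem_product, mem_range, Nat.lt_succ_iff] at hq
  rw [← hG.card_distCell _ q.1 q.2 (hG.dist_le x y) hq.1 hq.2 x y rfl, ← nsmul_eq_mul,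
    ← sum_const]
  have hc : (univ.filter fun z => (G.dist x z, G.dist y z) = q) = G.distCell q.1 q.2 x y := by
    ext z
    simp [mem_distCell, Prod.ext_iff]
  rw [hc]
  refine sum_congr rfl fun z hz => ?_
  rw [(mem_distCell.1 hz).1, (mem_distCell.1 hz).2]

theorem exists_adj (hG : G.IsDistanceRegularWith d p) (hd : 1 ≤ d) : ∃ x y, G.Adj x y := by
  obtain ⟨x, y, h⟩ := hG.exists_dist_eq hd
  exact ⟨x, y, dist_eq_one_iff_adj.1 h⟩

theorem exists_induced_path (hG : G.IsDistanceRegularWith d p) (hd : 2 ≤ d) :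
    ∃ x y z, G.Adj x y ∧ G.Adj y z ∧ G.dist x z = 2 := by
  obtain ⟨x, z, hxz⟩ := hG.exists_dist_eq hd
  obtain ⟨w, hw⟩ := hG.connected.exists_walk_length_eq_dist x z
  rw [hxz] at hw
  refine ⟨x, w.getVert 1, z, ?_, ?_, hxz⟩
  · simpa using w.adj_getVert_succ (i := 0) (by omega)
  · have := w.adj_getVert_succ (i := 1) (by omega)
    rwa [show 1 + 1 = w.length by omega, w.getVert_length] at this

theorem b_one_pos (hG : G.IsDistanceRegularWith d p) (hd : 2 ≤ d) : 0 < p 1 1 2 := by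
  obtain ⟨x, y, z, hxy, hyz, hxz⟩ := hG.exists_induced_path hd
  rw [← hG.card_distCell 1 1 2 (by omega) (by omega) hd y x (dist_eq_one_iff_adj.2 hxy.symm)]
  exact card_pos.2 ⟨z, mem_distCell.2 ⟨dist_eq_one_iff_adj.2 hyz, hxz⟩⟩

section

variable [DecidableRel G.Adj]

theorem card_neighborFinset (hG : G.IsDistanceRegularWith d p) (hd : 1 ≤ d) (x : V) :
    #(G.neighborFinset x) = p 0 1 1 := by
  rw [← hG.card_distCell 0 1 1 d.zero_le hd hd x x G.dist_self]
  congr 1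
  ext z
  simp [mem_distCell]

/-- The neighbours of `x` grouped by their distance to a neighbour `y` of `x`. -/
theorem sum_neighborFinset (hG : G.IsDistanceRegularWith d p) (hd : 2 ≤ d) {x y : V}
    (hxy : G.Adj x y) (e : ℕ → ℝ) :
    ∑ z ∈ G.neighborFinset x, e (G.dist y z) = e 0 + p 1 1 1 * e 1 + p 1 1 2 * e 2 := by
  have hm : ∀ z ∈ G.neighborFinset x, G.dist y z ∈ range 3 := fun z hz => by
    have h1 := hG.connected.dist_triangle (u := y) (v := x) (w := z)
    rw [dist_eq_one_iff_adj.2 hxy.symm,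
      dist_eq_one_iff_adj.2 ((G.mem_neighborFinset _ _).1 hz)] at h1
    rw [mem_range]
    omega
  have hc (j : ℕ) (hj : j ≤ d) :
      ∑ z ∈ (G.neighborFinset x).filter (fun z => G.dist y z = j), e (G.dist y z) =
        p 1 1 j * e j := by
    rw [← hG.card_distCell 1 1 j (by omega) (by omega) hj x y (dist_eq_one_iff_adj.2 hxy),
      ← nsmul_eq_mul, ← sum_const]
    refine sum_congr ?_ fun z hz => ?_
    · ext z
      simp [mem_distCell]
    · rw [(mem_distCell.1 hz).2]
  have h0 : p 1 1 0 = 1 := by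
    rw [← hG.card_distCell 1 1 0 (by omega) (by omega) (by omega) x y (dist_eq_one_iff_adj.2 hxy),
      card_eq_one]
    refine ⟨y, ?_⟩
    ext z
    rw [mem_distCell, mem_singleton, hG.connected.dist_eq_zero_iff, dist_eq_one_iff_adj]
    exact ⟨fun h => h.2.symm, fun h => ⟨h ▸ hxy, h.symm⟩⟩
  rw [← sum_fiberwise_of_maps_to hm, sum_range_succ, sum_range_succ, sum_range_one, hc 0 (by omega),
    hc 1 (by omega), hc 2 hd, h0]
  simp

theorem valency_eq (hG : G.IsDistanceRegularWith d p) (hd : 2 ≤ d) :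
    (p 0 1 1 : ℝ) = 1 + p 1 1 1 + p 1 1 2 := by
  obtain ⟨x, y, hxy⟩ := hG.exists_adj (by omega)
  have := hG.sum_neighborFinset hd hxy fun _ => 1
  simpa [hG.card_neighborFinset (by omega)] using this

end

/-! ### The Bose-Mesner algebra and the spectrum -/

variable [DecidableEq V] [DecidableRel G.Adj]

/-- The entries of an element of the Bose-Mesner algebra depend only on the distance. -/
theorem exists_apply_eq_of_mem_boseMesner (hG : G.IsDistanceRegularWith d p) {M : Matrix V V ℝ}
    (hM : M ∈ G.boseMesner) : ∃ m : ℕ → ℝ, ∀ x y, M x y = m (G.dist x y) := by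
  induction hM using Algebra.adjoin_induction with
  | mem M hM =>
    obtain rfl := Set.mem_singleton_iff.1 hM
    refine ⟨fun i => if i = 1 then 1 else 0, fun x y => ?_⟩
    simp [adjMatrix_apply]
  | algebraMap r =>
    refine ⟨fun i => if i = 0 then r else 0, fun x y => ?_⟩
    simp [Matrix.algebraMap_matrix_apply, hG.connected.dist_eq_zero_iff]
  | add M N _ _ hM hN =>
    obtain ⟨m, hm⟩ := hM
    obtain ⟨n, hn⟩ := hN
    exact ⟨fun i => m i + n i, fun x y => by rw [Matrix.add_apply, hm, hn]⟩
  | mul M N _ _ hM hN =>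
    obtain ⟨m, hm⟩ := hM
    obtain ⟨n, hn⟩ := hN
    refine ⟨fun h => ∑ i ∈ range (d + 1), ∑ j ∈ range (d + 1), p h i j * (m i * n j),
      fun x y => ?_⟩
    rw [Matrix.mul_apply]
    refine Eq.trans ?_ (hG.sum_dist (fun i j => m i * n j) x y)
    refine sum_congr rfl fun z _ => ?_
    rw [hm, hn, G.dist_comm (u := z)]

/-- There are eigenvalues on either side of `-1`, other than the valency. -/
theorem exists_mem_spectrum (hG : G.IsDistanceRegularWith d p) (hd : 2 ≤ d) :
    (∃ μ ∈ spectrum ℝ (G.adjMatrix ℝ), (μ - p 0 1 1) * (μ + 1) < 0) ∧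
      ∃ μ ∈ spectrum ℝ (G.adjMatrix ℝ), 0 < (μ - p 0 1 1) * (μ + 1) := by
  set A := G.adjMatrix ℝ with hA
  have hherm : A.IsHermitian := by
    rw [Matrix.IsHermitian, Matrix.conjTranspose_eq_transpose_of_trivial]
    exact G.transpose_adjMatrix
  -- Since A² has diagonal k and A has diagonal 0, q(A) = A² - (k-1)A - k has zero diagonal; at a
  -- pair at distance two it counts common neighbours.
  let q : Polynomial ℝ := (Polynomial.X - Polynomial.C (p 0 1 1 : ℝ)) * (Polynomial.X + 1)
  have hM : Polynomial.aeval A q = A * A - (p 0 1 1 - 1 : ℝ) • A - (p 0 1 1 : ℝ) • 1 := by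
    simp only [q, map_mul, map_sub, map_add, Polynomial.aeval_X, Polynomial.aeval_C, map_one,
      Algebra.algebraMap_eq_smul_one]
    simp only [sub_mul, mul_add, mul_one, smul_mul_assoc, one_mul, sub_smul, one_smul]
    abel
  have hherm' : (Polynomial.aeval A q).IsHermitian := by
    rw [hM, Matrix.IsHermitian]
    simp [hA]
  obtain ⟨x, y, z, hxy, hyz, hxz⟩ := hG.exists_induced_path hd
  have hdiag (u : V) : Polynomial.aeval A q u u = 0 := by
    rw [hM]
    have := hG.card_neighborFinset (by omega) u
    rw [card_neighborFinset_eq_degree] at this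
    rw [Matrix.sub_apply, Matrix.sub_apply, hA, adjMatrix_mul_self_apply_self, this]
    simp
  have hne : Polynomial.aeval A q x z ≠ 0 := by
    have hxz' : x ≠ z := by
      rintro rfl
      simp at hxz
    have hadj : ¬ G.Adj x z := fun h => by
      rw [dist_eq_one_iff_adj.2 h] at hxz
      omega
    rw [hM]
    simp only [Matrix.sub_apply, Matrix.smul_apply, hA, adjMatrix_apply, hadj, if_false,
      Matrix.one_apply_ne hxz', smul_zero, sub_zero, adjMatrix_mul_apply]
    refine (sum_pos' (fun i _ => by positivity) ⟨y, by simpa using hxy, ?_⟩).ne'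
    simp [hyz]
  have hq (μ : ℝ) : q.eval μ = (μ - p 0 1 1) * (μ + 1) := by simp [q]
  constructor
  · obtain ⟨_, hν, hlt⟩ := hherm'.exists_neg_mem_spectrum (hdiag x) (hdiag z) hne
    rw [hherm.spectrum_aeval] at hν
    obtain ⟨μ, hμ, rfl⟩ := hν
    exact ⟨μ, hμ, hq μ ▸ hlt⟩
  · have hneg : Polynomial.aeval A (-q) = -Polynomial.aeval A q := map_neg _ _
    obtain ⟨_, hν, hlt⟩ := hherm'.neg.exists_neg_mem_spectrum (u := x) (v := z)
      (by simp [hdiag]) (by simp [hdiag]) (by simpa using hne)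
    rw [← hneg, hherm.spectrum_aeval] at hν
    obtain ⟨μ, hμ, rfl⟩ := hν
    refine ⟨μ, hμ, ?_⟩
    simp only [Polynomial.eval_neg, hq] at hlt
    linarith

/-- The valency is an eigenvalue. -/
theorem valency_mem_spectrum (hG : G.IsDistanceRegularWith d p) (hd : 1 ≤ d) :
    (p 0 1 1 : ℝ) ∈ spectrum ℝ (G.adjMatrix ℝ) := by
  have := hG.connected.nonempty
  rw [← Matrix.spectrum_toLin']
  refine (Module.End.hasEigenvalue_of_hasEigenvector (x := Function.const V (1 : ℝ))
    ⟨?_, ?_⟩).mem_spectrum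
  · rw [Module.End.mem_eigenspace_iff]
    ext v
    have h := hG.card_neighborFinset hd v
    rw [card_neighborFinset_eq_degree] at h
    simp [-Function.const_one, adjMatrix_mulVec_apply, h]
  · exact fun h => one_ne_zero (congrFun h (Classical.arbitrary V))

end IsDistanceRegularWith

end SimpleGraph

/-! ### Cosines and the tightness inequality -/

namespace SimpleGraph

variable {V : Type*} [Fintype V] [DecidableEq V] {G : SimpleGraph V} {d : ℕ} {p : ℕ → ℕ → ℕ → ℕ}

namespace IsDistanceRegularWith

/-- Summing a function of the distance over the pairs of common neighbours of an edge. -/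
theorem sum_sum_distCell (hG : G.IsDistanceRegularWith d p) (hd : 2 ≤ d) {x y : V}
    (hxy : G.Adj x y) (ha : p 1 1 1 ≠ 0) (e : ℕ → ℝ) :
    ∑ z ∈ G.distCell 1 1 x y, ∑ w ∈ G.distCell 1 1 x y, e (G.dist z w) =
      p 1 1 1 * (e 0 + (p 1 1 1 - 1 - G.avgCoValency x y) * e 1 + G.avgCoValency x y * e 2) := by
  set D := G.distCell 1 1 x y with hD
  have hcard : #D = p 1 1 1 :=
    hG.card_distCell 1 1 1 (by omega) (by omega) (by omega) x y (dist_eq_one_iff_adj.2 hxy)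
  set N : ℝ := ((#((D ×ˢ D).filter fun q => G.dist q.1 q.2 = 2) : ℕ) : ℝ) with hN
  have hf : p 1 1 1 * G.avgCoValency x y = N := by
    rw [avgCoValency, ← hD, ← hN, hcard, mul_inv_cancel_left₀ (Nat.cast_ne_zero.2 ha)]
  have key (e : ℕ → ℝ) : ∑ z ∈ D, ∑ w ∈ D, e (G.dist z w) =
      p 1 1 1 * e 0 + #((D ×ˢ D).filter fun q => G.dist q.1 q.2 = 1) * e 1 + N * e 2 := by
    have hm : ∀ q ∈ D ×ˢ D, G.dist q.1 q.2 ∈ range 3 := fun q hq => by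
      have h1 := (mem_distCell.1 (mem_product.1 hq).1).1
      have h2 := (mem_distCell.1 (mem_product.1 hq).2).1
      have h3 := hG.connected.dist_triangle (u := q.1) (v := x) (w := q.2)
      rw [G.dist_comm (u := q.1) (v := x), h1, h2] at h3
      rw [mem_range]
      omega
    have hc (j : ℕ) : ∑ q ∈ (D ×ˢ D).filter (fun q => G.dist q.1 q.2 = j), e (G.dist q.1 q.2) =
        #((D ×ˢ D).filter fun q => G.dist q.1 q.2 = j) * e j := by
      rw [← nsmul_eq_mul, ← sum_const]
      exact sum_congr rfl fun q hq => by rw [(mem_filter.1 hq).2]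
    have h0 : #((D ×ˢ D).filter fun q => G.dist q.1 q.2 = 0) = p 1 1 1 := by
      rw [← hcard, ← diag_card D]
      refine congrArg card (Finset.ext fun q => ?_)
      simp only [mem_filter, mem_product, mem_diag, hG.connected.dist_eq_zero_iff]
      exact ⟨fun h => ⟨h.1.1, h.2⟩, fun h => ⟨⟨h.1, h.2 ▸ h.1⟩, h.2⟩⟩
    rw [← sum_product', ← sum_fiberwise_of_maps_to hm, sum_range_succ, sum_range_succ,
      sum_range_one, hc, hc, hc, h0]
  -- The constant function counts all a₁² pairs, which determines the number of adjacent ones.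
  have h1 := key fun _ => 1
  simp only [sum_const, hcard, nsmul_eq_mul, mul_one] at h1
  rw [key]
  linear_combination (e 1) * (h1.symm + hf) - (e 2) * hf

variable [DecidableRel G.Adj]

/-- The entries `e i` of a primitive idempotent at distance `i`. They are the inner products of
its columns, and satisfy the three-term recurrence of the (unnormalised) cosine sequence. -/
theorem exists_cosines (hG : G.IsDistanceRegularWith d p) (hd : 2 ≤ d) {θ : ℝ}
    {E : Matrix V V ℝ} (hE : G.IsPrimitiveIdempotent θ E) :
    ∃ e : ℕ → ℝ, 0 < e 0 ∧ (p 0 1 1 : ℝ) * e 1 = θ * e 0 ∧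
      e 0 + p 1 1 1 * e 1 + p 1 1 2 * e 2 = θ * e 1 ∧
      ∀ x y, (E *ᵥ Pi.single x 1) ⬝ᵥ (E *ᵥ Pi.single y 1) = e (G.dist x y) := by
  obtain ⟨e, he⟩ := hG.exists_apply_eq_of_mem_boseMesner hE.mem_boseMesner
  have hsymm (x y : V) : E x y = E y x := by rw [he, he, G.dist_comm]
  -- E is symmetric and idempotent, so EᵀE = E.
  have hdot (x y : V) : (E *ᵥ Pi.single x 1) ⬝ᵥ (E *ᵥ Pi.single y 1) = e (G.dist x y) := by
    rw [← he, mulVec_single_one, mulVec_single_one, dotProduct, ← congrFun₂ hE.mul_self x y,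
      Matrix.mul_apply]
    exact sum_congr rfl fun z _ => by rw [col_apply, col_apply, hsymm z x]
  have hmul (x y : V) : ∑ z ∈ G.neighborFinset x, e (G.dist y z) = θ * e (G.dist x y) := by
    have := congrFun₂ hE.adjMatrix_mul x y
    rw [adjMatrix_mul_apply, Matrix.smul_apply, he, smul_eq_mul] at this
    rw [← this]
    exact sum_congr rfl fun z _ => by rw [he, G.dist_comm]
  obtain ⟨x, y, hxy⟩ := hG.exists_adj (by omega)
  have h1 : G.dist x y = 1 := dist_eq_one_iff_adj.2 hxy
  refine ⟨e, ?_, ?_, ?_, hdot⟩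
  · have h0 (z : V) : (E *ᵥ Pi.single z 1) ⬝ᵥ (E *ᵥ Pi.single z 1) = e 0 := by
      rw [hdot, dist_self]
    refine lt_of_le_of_ne (h0 x ▸ sum_nonneg fun i _ => mul_self_nonneg _) fun hne => hE.ne_zero ?_
    ext u v
    have := dotProduct_self_eq_zero.1 ((h0 v).trans hne.symm)
    simpa using congrFun this u
  · have := hmul x x
    rw [dist_self, ← hG.card_neighborFinset (by omega) x] at *
    rw [← this, ← nsmul_eq_mul, ← sum_const]
    exact sum_congr rfl fun z hz => by
      rw [dist_eq_one_iff_adj.2 ((G.mem_neighborFinset _ _).1 hz)]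
  · rw [← hG.sum_neighborFinset hd hxy, hmul, h1]

/-- The squared norm of Ex - Ey for an edge xy is 2(e 0 - e 1), and k e 1 = θ e 0. -/
theorem le_valency (hG : G.IsDistanceRegularWith d p) (hd : 2 ≤ d) {θ : ℝ}
    (hθ : θ ∈ spectrum ℝ (G.adjMatrix ℝ)) : θ ≤ p 0 1 1 := by
  obtain ⟨E, hE, -⟩ := existsUnique_isPrimitiveIdempotent G θ hθ
  obtain ⟨e, h0, h1, -, hdot⟩ := hG.exists_cosines hd hE
  obtain ⟨x, y, hxy⟩ := hG.exists_adj (by omega)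
  have hxy1 := dist_eq_one_iff_adj.2 hxy
  have h : 0 ≤ (E *ᵥ Pi.single x 1 - E *ᵥ Pi.single y 1) ⬝ᵥ
      (E *ᵥ Pi.single x 1 - E *ᵥ Pi.single y 1) := sum_nonneg fun i _ => mul_self_nonneg _
  simp only [sub_dotProduct, dotProduct_sub, hdot, dist_self, G.dist_comm (u := y) (v := x),
    hxy1] at h
  have hk : (0 : ℝ) ≤ p 0 1 1 := Nat.cast_nonneg _
  refine le_of_mul_le_mul_right ?_ h0
  rw [← h1]
  exact mul_le_mul_of_nonneg_left (by linarith) hk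

/-- If the graph has triangles, then no eigenvalue is `-k`. -/
theorem neg_valency_lt (hG : G.IsDistanceRegularWith d p) (hd : 2 ≤ d) (ha : p 1 1 1 ≠ 0) {θ : ℝ}
    (hθ : θ ∈ spectrum ℝ (G.adjMatrix ℝ)) : 0 < p 0 1 1 + θ := by
  obtain ⟨E, hE, -⟩ := existsUnique_isPrimitiveIdempotent G θ hθ
  obtain ⟨e, h0, h1, -, hdot⟩ := hG.exists_cosines hd hE
  obtain ⟨x, y, hxy⟩ := hG.exists_adj (by omega)
  have hxy1 := dist_eq_one_iff_adj.2 hxy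
  rw [← hG.card_distCell 1 1 1 (by omega) (by omega) (by omega) x y hxy1, card_ne_zero] at ha
  obtain ⟨z, hz⟩ := ha
  obtain ⟨hxz, hyz⟩ := mem_distCell.1 hz
  -- For a triangle xyz this squared norm is 3 e 0 + 6 e 1, so e 1 ≥ -e 0 / 2 > -e 0.
  have h : 0 ≤ (E *ᵥ Pi.single x 1 + E *ᵥ Pi.single y 1 + E *ᵥ Pi.single z 1) ⬝ᵥ
      (E *ᵥ Pi.single x 1 + E *ᵥ Pi.single y 1 + E *ᵥ Pi.single z 1) :=
    sum_nonneg fun i _ => mul_self_nonneg _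
  simp only [add_dotProduct, dotProduct_add, hdot, dist_self, G.dist_comm (u := y) (v := x),
    G.dist_comm (u := z), hxy1, hxz, hyz] at h
  have hk : (0 : ℝ) < p 0 1 1 := by
    rw [hG.valency_eq hd]
    positivity
  have h2 : 0 < p 0 1 1 * (e 0 + e 1) := mul_pos hk (by linarith)
  rw [mul_add, h1, ← add_mul] at h2
  exact pos_of_mul_pos_left h2 h0.le

/-- The Gram determinant inequality for an edge, with equality if and only if it is tight. -/
theorem avgCoValency_mul_le (hG : G.IsDistanceRegularWith d p) (hd : 2 ≤ d)
    (ha : p 1 1 1 ≠ 0) {θ : ℝ} (hθ : θ ∈ spectrum ℝ (G.adjMatrix ℝ)) (hlt : θ < p 0 1 1)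
    {x y : V} (hxy : G.Adj x y) :
    G.avgCoValency x y * ((p 0 1 1 + θ) * (1 + θ)) ≤
        p 1 1 2 * (p 0 1 1 + θ * (p 1 1 1 + 1)) ∧
      (G.IsTightEdge θ x y ↔ G.avgCoValency x y * ((p 0 1 1 + θ) * (1 + θ)) =
        p 1 1 2 * (p 0 1 1 + θ * (p 1 1 1 + 1))) := by
  obtain ⟨E, hE, huniq⟩ := existsUnique_isPrimitiveIdempotent G θ hθ
  obtain ⟨e, h0, h1, h2, hdot⟩ := hG.exists_cosines hd hE
  have hb : (0 : ℝ) < p 1 1 2 := Nat.cast_pos.2 (hG.b_one_pos hd)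
  have hk := hG.valency_eq hd
  have hgt := hG.neg_valency_lt hd ha hθ
  have hsum := hG.sum_sum_distCell hd hxy ha e
  have ha' : (0 : ℝ) < p 1 1 1 := Nat.cast_pos.2 (Nat.pos_of_ne_zero ha)
  have hxy1 := dist_eq_one_iff_adj.2 hxy
  have hcard := hG.card_distCell 1 1 1 (by omega) (by omega) (by omega) x y hxy1
  set f := G.avgCoValency x y
  set D := G.distCell 1 1 x y with hD
  have hw : E *ᵥ (∑ z ∈ D, Pi.single z 1) = ∑ z ∈ D, E *ᵥ Pi.single z 1 := by
    rw [← mulVec_sum]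
  have hdotw (u : V) (hu : ∀ z ∈ D, G.dist u z = 1) :
      (E *ᵥ Pi.single u 1) ⬝ᵥ (E *ᵥ (∑ z ∈ D, Pi.single z 1)) = p 1 1 1 * e 1 := by
    rw [hw, dotProduct_sum, ← hcard, ← nsmul_eq_mul, ← sum_const]
    exact sum_congr rfl fun z hz => by rw [hdot, hu z hz]
  have hww : (E *ᵥ (∑ z ∈ D, Pi.single z 1)) ⬝ᵥ (E *ᵥ (∑ z ∈ D, Pi.single z 1)) =
      p 1 1 1 * (e 0 + (p 1 1 1 - 1 - f) * e 1 + f * e 2) := by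
    rw [← hsum, hw, sum_dotProduct]
    refine sum_congr rfl fun z _ => ?_
    rw [dotProduct_sum]
    exact sum_congr rfl fun w _ => hdot z w
  have htight : G.IsTightEdge θ x y ↔ ¬ LinearIndependent ℝ ![E *ᵥ Pi.single x 1,
      E *ᵥ Pi.single y 1, E *ᵥ (∑ z ∈ D, Pi.single z 1)] := by
    constructor
    · rintro ⟨F, hF, h⟩
      rwa [huniq F hF] at h
    · exact fun h => ⟨E, hE, h⟩
  generalize (p 0 1 1 : ℝ) = k at *
  generalize (p 1 1 1 : ℝ) = a at *
  generalize (p 1 1 2 : ℝ) = b at *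
  have hkpos : 0 < k := by linarith
  have he1 : e 1 = θ / k * e 0 := by
    field_simp
    linear_combination h1
  -- Here c = e 0, s = e 1 and t = a e 1; the conditions s < c and 0 < c + s come from θ < k and k +
  -- θ > 0.
  have hgram := gram_three_of_isosceles (by rw [hdot, dist_self]) (by rw [hdot, dist_self])
    (by rw [hdot, hxy1]) (hdotw x fun z hz => (mem_distCell.1 hz).1)
    (hdotw y fun z hz => (mem_distCell.1 hz).2) hww
    (by
      refine lt_of_mul_lt_mul_left ?_ hkpos.le
      rw [h1]
      exact mul_lt_mul_of_pos_right hlt h0)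
    (by
      refine pos_of_mul_pos_right (a := k) ?_ hkpos.le
      rw [mul_add, h1, ← add_mul]
      positivity)
  have hdet : a * (e 0 + (a - 1 - f) * e 1 + f * e 2) * (e 0 + e 1) - 2 * (a * e 1) ^ 2 =
      a * e 0 ^ 2 * (k - θ) / (b * k ^ 2) *
        (b * (k + θ * (a + 1)) - f * ((k + θ) * (1 + θ))) := by
    have he2 : e 2 = (θ * e 1 - e 0 - a * e 1) / b := by
      field_simp
      linear_combination h2
    rw [he2, he1]
    have hb' := hb.ne'
    have hk' := hkpos.ne'
    obtain rfl : b = k - 1 - a := by linarith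
    field_simp
    ring
  have hc : 0 < a * e 0 ^ 2 * (k - θ) / (b * k ^ 2) := by
    have : 0 < k - θ := sub_pos.2 hlt
    positivity
  rw [hdet, ← htight, mul_eq_zero, or_iff_right hc.ne', sub_eq_zero] at hgram
  exact ⟨sub_nonneg.1 (nonneg_of_mul_nonneg_right hgram.1 hc), hgram.2.trans eq_comm⟩

end IsDistanceRegularWith

end SimpleGraph

/-! ### Monotonicity of the bound -/

/-- The function `θ ↦ b (k + θ (a + 1)) / ((k + θ) (1 + θ))` is strictly decreasing on each side
of `-1`. -/
theorem tight_bound_lt {a b k s t : ℝ} (ha : 0 < a) (hb : 0 < b) (hk : k = 1 + a + b)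
    (hs : 0 < k + s) (hst : s < t) (h : 0 < (1 + s) * (1 + t)) :
    b * ((k + t * (a + 1)) / ((k + t) * (1 + t))) <
      b * ((k + s * (a + 1)) / ((k + s) * (1 + s))) := by
  have ht : 0 < k + t := by linarith
  have hs1 : 1 + s ≠ 0 := fun h' => by simp [h'] at h
  have ht1 : 1 + t ≠ 0 := fun h' => by simp [h'] at h
  refine mul_lt_mul_of_pos_left ?_ hb
  rw [← sub_pos]
  -- Partial fractions: as k - 1 = a + b, the quotient at t is (ka/(k+t) + b/(1+t))/(a+b), a
  -- positive combination of reciprocals.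
  have : (k + s * (a + 1)) / ((k + s) * (1 + s)) - (k + t * (a + 1)) / ((k + t) * (1 + t)) =
      (t - s) * (k * a / ((k + s) * (k + t)) + b / ((1 + s) * (1 + t))) / (a + b) := by
    subst hk
    have : a + b ≠ 0 := by positivity
    field_simp
    ring
  rw [this]
  have : 0 < t - s := sub_pos.2 hst
  have : 0 < k := by linarith
  positivity

end

/-! ### The fundamental bound and tight edges -/

theorem theorem3p5 {V : Type*} [Fintype V] [DecidableEq V]
    (G : SimpleGraph V) [DecidableRel G.Adj]
    (d : ℕ) (hd : 3 ≤ d) (p : ℕ → ℕ → ℕ → ℕ) (hG : G.IsDistanceRegularWith d p)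
    (k a₁ b₁ : ℕ) (hk : k = p 0 1 1) (ha₁ : a₁ = p 1 1 1) (hb₁ : b₁ = p 1 1 2)
    (ha₁_ne : a₁ ≠ 0)
    (θ : Fin (d + 1) → ℝ) (hθ : StrictAnti θ)
    (hθ_eig : Set.range θ = spectrum ℝ (G.adjMatrix ℝ))
    (x y : V) (hxy : G.Adj x y) :
    (b₁ * ((k + θ (Fin.last d) * (a₁ + 1)) /
        ((k + θ (Fin.last d)) * (1 + θ (Fin.last d)))) ≤ G.avgCoValency x y ∧
      G.avgCoValency x y ≤
        b₁ * ((k + θ 1 * (a₁ + 1)) / ((k + θ 1) * (1 + θ 1)))) ∧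
    (G.IsTightEdge (θ 1) x y ↔
      G.avgCoValency x y = b₁ * ((k + θ 1 * (a₁ + 1)) / ((k + θ 1) * (1 + θ 1)))) ∧
    (G.IsTightEdge (θ (Fin.last d)) x y ↔
      b₁ * ((k + θ (Fin.last d) * (a₁ + 1)) /
        ((k + θ (Fin.last d)) * (1 + θ (Fin.last d)))) = G.avgCoValency x y) ∧
    (∀ i : Fin (d + 1), 2 ≤ (i : ℕ) → (i : ℕ) ≤ d - 1 → ¬ G.IsTightEdge (θ i) x y) := by
  subst hk ha₁ hb₁
  have hd2 : 2 ≤ d := by omega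
  have hmem (i : Fin (d + 1)) : θ i ∈ spectrum ℝ (G.adjMatrix ℝ) := hθ_eig ▸ Set.mem_range_self i
  have h1v : ((1 : Fin (d + 1)) : ℕ) = 1 := by
    rw [Fin.val_one', Nat.mod_eq_of_lt (by omega)]
  have hlt (i : Fin (d + 1)) (hi : i ≠ 0) : θ i < p 0 1 1 :=
    (hθ (Fin.pos_of_ne_zero hi)).trans_le (hG.le_valency hd2 (hmem 0))
  have hgt (i : Fin (d + 1)) := hG.neg_valency_lt hd2 ha₁_ne (hmem i)
  have h10 : (1 : Fin (d + 1)) ≠ 0 := fun h => by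
    have := congrArg Fin.val h
    simp at this
    omega
  have hl0 : Fin.last d ≠ 0 := fun h => by
    have := congrArg Fin.val h
    simp at this
    omega
  have hθ0 : θ 0 = p 0 1 1 := by
    refine le_antisymm (hG.le_valency hd2 (hmem 0)) ?_
    have := hG.valency_mem_spectrum (by omega)
    rw [← hθ_eig] at this
    obtain ⟨i, hi⟩ := this
    exact hi ▸ hθ.antitone (Fin.zero_le i)
  obtain ⟨⟨μ, hμ, hμ1⟩, ν, hν, hν1⟩ := hG.exists_mem_spectrum hd2
  -- A negative value of (μ-k)(μ+1) needs -1 < μ < k, so μ is not θ₀ and θ₁ ≥ μ.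
  have hθ1 : 0 < 1 + θ 1 := by
    rw [← hθ_eig] at hμ
    obtain ⟨i, rfl⟩ := hμ
    have hi : i ≠ 0 := by
      rintro rfl
      simp [hθ0] at hμ1
    have h1i : (1 : Fin (d + 1)) ≤ i := by
      rw [Fin.le_def, h1v]
      exact Nat.one_le_iff_ne_zero.2 fun h => hi (Fin.ext h)
    have h2 := hθ.antitone h1i
    have h3 : 0 < θ i + 1 := by
      by_contra! h
      exact absurd hμ1 (not_lt.2 (mul_nonneg_of_nonpos_of_nonpos (by linarith [hlt i hi]) h))
    linarith
  -- No eigenvalue exceeds k, so a positive value of (ν-k)(ν+1) needs ν < -1.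
  have hθd : 1 + θ (Fin.last d) < 0 := by
    have h2 := hG.le_valency hd2 hν
    rw [← hθ_eig] at hν
    obtain ⟨i, rfl⟩ := hν
    have h3 := hθ.antitone (Fin.le_last i)
    have h4 : θ i + 1 < 0 := by
      by_contra! h
      exact absurd hν1 (not_lt.2 (mul_nonpos_of_nonpos_of_nonneg (by linarith) h))
    linarith
  have key (i : Fin (d + 1)) (hi : i ≠ 0) :=
    hG.avgCoValency_mul_le hd2 ha₁_ne (hmem i) (hlt i hi) hxy
  have hne (i : Fin (d + 1)) (hi : 1 + θ i ≠ 0) (f : ℝ) :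
      f * ((p 0 1 1 + θ i) * (1 + θ i)) = p 1 1 2 * (p 0 1 1 + θ i * (p 1 1 1 + 1)) ↔
        f = p 1 1 2 * ((p 0 1 1 + θ i * (p 1 1 1 + 1)) / ((p 0 1 1 + θ i) * (1 + θ i))) := by
    rw [← mul_div_assoc, eq_div_iff (mul_ne_zero (hgt i).ne' hi)]
  have hlower := (key _ hl0).1
  have hupper := (key 1 h10).1
  rw [← div_le_iff_of_neg (mul_neg_of_pos_of_neg (hgt _) hθd), mul_div_assoc] at hlower
  rw [← le_div_iff₀ (mul_pos (hgt _) hθ1), mul_div_assoc] at hupper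
  refine ⟨⟨hlower, hupper⟩, ?_, ?_, ?_⟩
  · rw [(key 1 h10).2, hne 1 hθ1.ne']
  · rw [(key _ hl0).2, hne _ hθd.ne, eq_comm]
  intro i hi2 hid htight
  have hi0 : i ≠ 0 := by
    rintro rfl
    simp at hi2
  have hb : (0 : ℝ) < p 1 1 2 := Nat.cast_pos.2 (hG.b_one_pos hd2)
  have ha : (0 : ℝ) < p 1 1 1 := Nat.cast_pos.2 (Nat.pos_of_ne_zero ha₁_ne)
  have hk := hG.valency_eq hd2
  have hlt1 : θ i < θ 1 := hθ (by rw [Fin.lt_def, h1v]; omega)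
  have hltd : θ (Fin.last d) < θ i := hθ (by rw [Fin.lt_def, Fin.val_last]; omega)
  rw [(key i hi0).2] at htight
  -- Below -1, tightness would put f under the bound at θ_d; above -1, over the bound at θ₁. At θ_i
  -- = -1 it would read 0 = b₁(k - a₁ - 1) = b₁².
  rcases lt_trichotomy (1 + θ i) 0 with h | h | h
  · rw [hne i h.ne] at htight
    have := tight_bound_lt ha hb hk (hgt _) hltd (mul_pos_of_neg_of_neg hθd h)
    linarith
  · rw [h, mul_zero, mul_zero, eq_comm, mul_eq_zero, or_iff_right hb.ne',
      show θ i = -1 by linarith] at htight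
    linarith
  · rw [hne i h.ne'] at htight
    have := tight_bound_lt ha hb hk (hgt _) hlt1 (mul_pos h hθ1)
    linarith
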